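/- Let $S^2\subset\mathbb R^3$ be the unit sphere with the round metric. For $\theta\in\mathbb R$ let $\gamma_\theta(s)=(\sin s\cos\theta,\ \sin s\sin\theta,\ -\cos s)$, $0\le s\le 2\pi$, be the great circle that leaves the south pole $(0,0,-1)$ with angle $\theta$ and passes the north pole at $s=\pi$. Let $u\colon\mathbb R\to\mathbb R$ be a smooth function with $u(-s)=u(s)$, $u(2\pi+s)=u(2\pi-s)$ for all $s$, with $u'<0$ on $(0,2\pi)$, and with $u''(0)<0<u''(2\pi)$ (for example $u(s)=\cos(s/2)$). Let $L_{knot}\subset J^1(S^2)=T^*S^2\times\mathbb R$ be the Legendrian sphere with the rotationally symmetric front of profile $u$, that is $$L_{knot}=\bigl\{\bigl(\gamma_\theta(s),\ u'(s)\langle\dot\gamma_\theta(s),\cdot\rangle,\ u(s)\bigr)\ :\ \theta\in\mathbb R,\ 0\le s\le 2\pi\bigr\}.$$ (Its front has two sheets over $S^2$, which meet in a front cone above the north pole; its only Reeb chord lies above the south pole and is of maximum type.) A generating family for a Legendrian submanifold $L\subset J^1(M)$ with fibre a smooth manifold $E$ is a smooth function $F\colon M\times E\to\mathbb R$ such that $$L=\bigl\{(q,p,z)\in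 J^1(M)\ :\ \text{there is } w\in E \text{ with } \partial_wF(q,w)=0,\ p=\partial_qF(q,w),\ z=F(q,w)\bigr\}.$$ **Proposition.** $L_{knot}$ has no generating family $F\colon S^2\times S^1\to\mathbb R$. -/

import Mathlib

open scoped Manifold ContDiff

/-- The 1-jet space `J¹(M) = T^*M × ℝ` of a manifold `M`: a base point `q`, a cotangent vector `p`
at `q` and a height `z`. -/
structure JetOne {𝕍 H : Type*} [NormedAddCommGroup 𝕍] [NormedSpace ℝ 𝕍] [TopologicalSpace H]
    (I : ModelWithCorners ℝ 𝕍 H) (M : Type*) [TopologicalSpace M] [ChartedSpace H M] where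
  /-- the base point -/
  q : M
  /-- the cotangent vector -/
  p : TangentSpace I q →L[ℝ] ℝ
  /-- the coordinate of the `ℝ`-factor -/
  z : ℝ

/-- `F : M × E → ℝ` is a generating family for `L ⊆ J¹(M)`: `F` is smooth and `L` consists exactly
of the points `(q, ∂F/∂q (q, w), F (q, w))` with `∂F/∂w (q, w) = 0`. -/
def IsGeneratingFamily
    {𝕍 H : Type*} [NormedAddCommGroup 𝕍] [NormedSpace ℝ 𝕍] [TopologicalSpace H]
    (I : ModelWithCorners ℝ 𝕍 H) {M : Type*} [TopologicalSpace M] [ChartedSpace H M]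
    {𝕍' H' : Type*} [NormedAddCommGroup 𝕍'] [NormedSpace ℝ 𝕍'] [TopologicalSpace H']
    (J : ModelWithCorners ℝ 𝕍' H') {E : Type*} [TopologicalSpace E] [ChartedSpace H' E]
    (F : M × E → ℝ) (L : Set (JetOne I M)) : Prop :=
  ContMDiff (I.prod J) 𝓘(ℝ, ℝ) ∞ F ∧
    L = {x : JetOne I M | ∃ w : E,
      mfderiv J 𝓘(ℝ, ℝ) (fun w' : E => F (x.q, w')) w = 0 ∧
      x.p = mfderiv I 𝓘(ℝ, ℝ) (fun q' : M => F (q', w)) x.q ∧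
      x.z = F (x.q, w)}

/-- The unit sphere in `ℝ³`. -/
abbrev TwoSphere : Type := Metric.sphere (0 : EuclideanSpace ℝ (Fin 3)) 1

/-- The great circle `γ_θ`, parametrized by arc length: it leaves the south pole `(0, 0, -1)` at
time `0` in the direction `(cos θ, sin θ, 0)`, passes the north pole at time `π` and is back at the
south pole at time `2π`. -/
noncomputable def meridian (θ s : ℝ) : EuclideanSpace ℝ (Fin 3) :=
  !₂[Real.sin s * Real.cos θ, Real.sin s * Real.sin θ, -Real.cos s]

/-- Profiles of the rotationally symmetric front of `L_knot`: `u s` is the height of the front above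
`γ_θ(s)`, `0 ≤ s ≤ 2π`, for every `θ`. -/
structure IsKnotProfile (u : ℝ → ℝ) : Prop where
  smooth : ContDiff ℝ ∞ u
  /-- with `symm_end`: the two sheets are smooth functions on the sphere at the south pole -/
  symm_start : ∀ s, u (-s) = u s
  symm_end : ∀ s, u (2 * Real.pi + s) = u (2 * Real.pi - s)
  /-- in particular, there is a front cone above the north pole `s = π` -/
  deriv_neg : ∀ s ∈ Set.Ioo 0 (2 * Real.pi), deriv u s < 0
  /-- the upper sheet has a non-degenerate maximum at the south pole -/
  max_start : iteratedDeriv 2 u 0 < 0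
  /-- the lower sheet has a non-degenerate minimum at the south pole -/
  min_end : 0 < iteratedDeriv 2 u (2 * Real.pi)

/-- The Legendrian sphere `L_knot ⊆ J¹(S²)` with front profile `u`: the set of the points
`(q, p, z)` with `q = γ_θ(s)`, `p = u'(s) ⟨γ_θ'(s), ·⟩` (round metric of `S² ⊆ ℝ³`), `z = u(s)`. -/
noncomputable def knottedSphere (u : ℝ → ℝ) : Set (JetOne (𝓡 2) TwoSphere) :=
  {x | ∃ θ : ℝ, ∃ s ∈ Set.Icc 0 (2 * Real.pi),
    (x.q : EuclideanSpace ℝ (Fin 3)) = meridian θ s ∧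
    (∀ v : TangentSpace (𝓡 2) x.q, x.p v = deriv u s *
      inner ℝ (deriv (meridian θ) s)
        (mfderiv (𝓡 2) 𝓘(ℝ, EuclideanSpace ℝ (Fin 3))
          (fun y : TwoSphere => (y : EuclideanSpace ℝ (Fin 3))) x.q v)) ∧
    x.z = u s}

/-!
Suppose that `F : S² × S¹ → ℝ` generates `L_knot`. Above a point at distance `s < π` from the south
pole the front has exactly the two heights `u s > u (2π - s)`, so the function on the fibre has no
other critical values, and the height `midHeight u s` halfway between them is a regular value. Over
`S²` minus the north pole, which inverse stereographic projection identifies with `ℂ`, the set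
`F = midHeight u s` is therefore a covering (`exists_continuous_levelSection`: the fibre `S¹` is
compact). It is non-empty, and `ℂ` is simply connected, so it has a continuous section, which lifts
to `X : ℂ → ℝ` along `Circle.exp` (`exists_midHeight_section`).

Above the north pole the front has the single height `u π`, so `F` is constant on this fibre and
all its points are critical (`fibre_northPole_eq`). The radial derivative of `F` there, in the
direction `α` and at the point `exp (i x)` of the fibre, is thus `u' π * cos (α - Θ x)` for a
function `Θ` (`exists_angle_northPole`), which can be chosen continuous (`exists_continuous_angle`).
Both `F` and `midHeight u` are equal to `u π` at the north pole, and the radial derivative of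
`midHeight u` vanishes there. By Rolle's theorem and compactness (`eventually_abs_deriv_lt`), on the
level set `F = midHeight u s` the value `|cos (α - Θ x)|` is less than `1` for `s` close to `π`.

On a large circle `|b| = R` in `ℂ` this applies to `x = X (R * exp (i α))`. But
`Θ (X (R * exp (i α)))` is a continuous `2π`-periodic function of `α`, since the section extends
over the disc and has been lifted to `ℝ`. So `α - Θ (X (R * exp (i α)))` grows by `2π` along the
circle and passes a multiple of `π` (`exists_abs_cos_sub_eq_one`), which is a contradiction.
-/

/-! ### Sections of level sets in families of functions on the circle -/

/-- If the derivative along the circle does not vanish at `(b, w)`, then `(b, w) ↦ (b, f (b, w))` is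
a local homeomorphism there. -/
theorem isLocalHomeomorphOn_fst_prodMk {V : Type*} [NormedAddCommGroup V] [NormedSpace ℝ V]
    [CompleteSpace V] {f : V × Circle → ℝ}
    (hf : ContDiff ℝ 1 fun p : V × ℝ => f (p.1, Circle.exp p.2)) {A : Set (V × Circle)}
    (hA : ∀ b x, (b, Circle.exp x) ∈ A → deriv (fun y => f (b, Circle.exp y)) x ≠ 0) :
    IsLocalHomeomorphOn (fun p : V × Circle => (p.1, f p)) A := by
  refine IsLocalHomeomorphOn.mk _ _ ?_
  rintro ⟨b, w⟩ hw
  obtain ⟨x, rfl⟩ := Circle.isAddQuotientCoveringMap_exp.surjective w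
  obtain ⟨φ, hφ, hφe⟩ := isLocalHomeomorph_circleExp x
  set g : V × ℝ → ℝ := fun p => f (p.1, Circle.exp p.2) with hg
  have hd : HasStrictFDerivAt g (fderiv ℝ g (b, x)) (b, x) :=
    hf.contDiffAt.hasStrictFDerivAt one_ne_zero
  have hc : fderiv ℝ g (b, x) (0, 1) ≠ 0 := by
    have h1 : HasDerivAt (fun y : ℝ => (b, y)) ((0 : V), (1 : ℝ)) x :=
      (hasDerivAt_const x b).prodMk (hasDerivAt_id x)
    have h2 := (hd.hasFDerivAt.comp_hasDerivAt x h1).deriv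
    have h3 := hA b x hw
    intro h0
    exact h3 (h2.trans h0)
  set c : ℝ := fderiv ℝ g (b, x) (0, 1)
  -- the derivative of `(b, y) ↦ (b, g (b, y))` is triangular with diagonal entries `1` and `c`
  let e : (V × ℝ) ≃L[ℝ] (V × ℝ) :=
    (ContinuousLinearEquiv.refl ℝ V).skewProd
      (ContinuousLinearEquiv.unitsEquivAut ℝ (Units.mk0 c hc))
      ((fderiv ℝ g (b, x)).comp (ContinuousLinearMap.inl ℝ V ℝ))
  have he : HasStrictFDerivAt (fun p : V × ℝ => (p.1, g p)) (e : (V × ℝ) →L[ℝ] (V × ℝ)) (b, x) := by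
    have h1 : HasStrictFDerivAt (fun p : V × ℝ => (p.1, g p)) _ (b, x) :=
      hasStrictFDerivAt_fst.prodMk hd
    convert! h1 using 1
    ext v
    · simp [e]
    · simp [e]
    · simp [e]
    · have : fderiv ℝ g (b, x) (0, 0) = 0 := map_zero _
      simp [e, c, this]
  let ψ := he.toOpenPartialHomeomorph _
  refine ⟨((OpenPartialHomeomorph.refl V).prod φ.symm).trans ψ, ?_, ?_⟩
  · have h1 : φ.symm (Circle.exp x) = x := by rw [hφe]; exact φ.left_inv hφ
    have h2 : Circle.exp x ∈ φ.target := by rw [hφe]; exact φ.map_source hφ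
    simp [h2, h1, ψ, he.mem_toOpenPartialHomeomorph_source]
  · rintro ⟨b', w'⟩ hw'
    have h2 : w' ∈ φ.target := by
      have := hw'.1
      simpa using this
    have h3 : Circle.exp (φ.symm w') = w' := by rw [hφe]; exact φ.right_inv h2
    simp [ψ, g, h3]

/-- The projection of a transverse level set is a covering of the simply connected base `V`,
since the fibre is compact; its sections lift further along `ℝ → S¹`. -/
theorem exists_continuous_levelSection {V : Type*} [NormedAddCommGroup V] [NormedSpace ℝ V]
    [CompleteSpace V] {f : V × Circle → ℝ} (hf₀ : Continuous f)
    (hf : ContDiff ℝ 1 fun p : V × ℝ => f (p.1, Circle.exp p.2)) {m : V → ℝ} (hm : Continuous m)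
    (hreg : ∀ b x, f (b, Circle.exp x) = m b → deriv (fun y => f (b, Circle.exp y)) x ≠ 0)
    {b₀ : V} {w₀ : Circle} (h₀ : f (b₀, w₀) = m b₀) :
    ∃ X : V → ℝ, Continuous X ∧ ∀ b, f (b, Circle.exp (X b)) = m b := by
  set Φ : V × Circle → V × ℝ := fun p => (p.1, f p)
  have hproper : IsProperMap Φ :=
    isProperMap_of_comp_of_t2 (g := Prod.fst) (by fun_prop) continuous_fst
      isProperMap_fst_of_compactSpace
  set s : Set (V × ℝ) := Set.range fun b => (b, m b)
  have hloc : IsLocalHomeomorphOn Φ (Φ ⁻¹' s) := by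
    refine isLocalHomeomorphOn_fst_prodMk hf ?_
    rintro b x ⟨b', hb'⟩
    obtain ⟨rfl, h⟩ := Prod.mk.inj hb'
    exact hreg _ x h.symm
  have hcov : IsCoveringMapOn Φ s := by
    refine hproper.isClosedMap.isCoveringMapOn_of_isLocalHomeomorphOn (fun y hy => ?_) hloc
    refine (hproper.isCompact_preimage isCompact_singleton).finite
      (.of_openPartialHomeomorph Φ subset_rfl fun e he => ?_)
    obtain ⟨φ, h1, h2⟩ := hloc e (by rw [Set.mem_preimage, Set.mem_singleton_iff.1 he]; exact hy)
    exact ⟨φ, h1, h2.symm⟩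
  obtain ⟨σ, ⟨-, hσ⟩, -⟩ := hcov.existsUnique_continuousMap_lifts
    (⟨fun b => (b, m b), by fun_prop⟩ : C(V, V × ℝ)) (a₀ := b₀) (e₀ := (b₀, w₀))
    (by simp [Φ, h₀]) (fun b => ⟨b, rfl⟩)
  obtain ⟨x₀, hx₀⟩ := Circle.isAddQuotientCoveringMap_exp.surjective (σ b₀).2
  obtain ⟨X, ⟨-, hX⟩, -⟩ := Circle.isCoveringMap_exp.existsUnique_continuousMap_lifts
    (⟨fun b => (σ b).2, by fun_prop⟩ : C(V, Circle)) b₀ x₀ hx₀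
  refine ⟨X, X.continuous, fun b => ?_⟩
  have h1 := congrFun hσ b
  have h2 : Circle.exp (X b) = (σ b).2 := congrFun hX b
  simp only [Φ, Function.comp_apply, ContinuousMap.coe_mk, Prod.mk.injEq] at h1
  rw [h2, ← h1.2]
  exact congrArg f (Prod.ext h1.1.symm rfl)

/-! ### Angles of circle-valued maps and a uniform form of Rolle's theorem -/

/-- A continuous choice of the angles of a continuous curve in the unit circle, given through the
coordinates with respect to all unit vectors. -/
theorem exists_continuous_angle {P : ℝ → ℝ → ℝ} (hP : ∀ α, Continuous fun x => P α x)
    (h : ∀ x, ∃ θ, ∀ α, P α x = Real.cos (α - θ)) :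
    ∃ Θ : ℝ → ℝ, Continuous Θ ∧ ∀ x α, P α x = Real.cos (α - Θ x) := by
  choose θ hθ using h
  have hc : Continuous fun x => Circle.exp (θ x) := by
    have : (fun x => (Circle.exp (θ x) : ℂ)) =
        fun x => (P 0 x : ℂ) + P (Real.pi / 2) x * Complex.I := by
      ext x
      rw [hθ x, hθ x, Real.cos_pi_div_two_sub, zero_sub, Real.cos_neg, Circle.coe_exp,
        Complex.exp_mul_I, Complex.ofReal_cos, Complex.ofReal_sin]
    have h0 := hP 0
    have h1 := hP (Real.pi / 2)
    have h2 : Continuous fun x => (Circle.exp (θ x) : ℂ) := by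
      rw [this]
      fun_prop
    exact continuous_induced_rng.2 h2
  obtain ⟨Θ, ⟨-, hΘ⟩, -⟩ := Circle.isCoveringMap_exp.existsUnique_continuousMap_lifts
    (⟨_, hc⟩ : C(ℝ, Circle)) 0 (θ 0) rfl
  refine ⟨Θ, Θ.continuous, fun x α => ?_⟩
  have h1 : Circle.exp (Θ x) = Circle.exp (θ x) := congrFun hΘ x
  obtain ⟨n, hn⟩ := Circle.exp_eq_exp.1 h1
  rw [hθ x α, hn, show α - (θ x + n * (2 * Real.pi)) = (α - θ x) - n * (2 * Real.pi) by ring,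
    Real.cos_sub_int_mul_two_pi]

/-- A difference of `α` and a `2π`-periodic function of `α` assumes a multiple of `π`, so its cosine
assumes the value `±1`. -/
theorem exists_abs_cos_sub_eq_one {Θ : ℝ → ℝ} (hΘ : Continuous Θ)
    (hper : Θ (2 * Real.pi) = Θ 0) :
    ∃ α ∈ Set.Icc 0 (2 * Real.pi), |Real.cos (α - Θ α)| = 1 := by
  have hpi := Real.pi_pos
  set k : ℤ := ⌈-Θ 0 / (2 * Real.pi)⌉ with hk
  have h1 : -Θ 0 ≤ k * (2 * Real.pi) := (div_le_iff₀ (by positivity)).1 (Int.le_ceil _)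
  have h2 : k * (2 * Real.pi) ≤ -Θ 0 + 2 * Real.pi := by
    have := (Int.ceil_lt_add_one (-Θ 0 / (2 * Real.pi))).le
    rw [← hk] at this
    have h3 := mul_le_mul_of_nonneg_right this (by positivity : 0 ≤ 2 * Real.pi)
    rwa [add_mul, div_mul_cancel₀ _ (by positivity), one_mul] at h3
  obtain ⟨α, hα, h⟩ := intermediate_value_Icc (f := fun α => α - Θ α)
    (by positivity : (0 : ℝ) ≤ 2 * Real.pi) (by fun_prop)
    (⟨by linarith, by rw [hper]; linarith⟩ :
      (k * (2 * Real.pi) : ℝ) ∈ Set.Icc (0 - Θ 0) (2 * Real.pi - Θ (2 * Real.pi)))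
  refine ⟨α, hα, ?_⟩
  simp only at h
  rw [h, Real.cos_int_mul_two_pi, abs_one]

/-- Rolle's theorem, uniformly over a compact set of parameters: near `s₀` the zeros of `g`, which
vanishes at `s₀`, have small derivative at `s₀`. -/
theorem eventually_abs_deriv_lt {K : Set (ℝ × ℝ)} (hK : IsCompact K) {g g' : ℝ → ℝ × ℝ → ℝ}
    (hg : ∀ s p, HasDerivAt (fun s => g s p) (g' s p) s) (hg' : Continuous (Function.uncurry g'))
    {s₀ r : ℝ} (hr : 0 < r) (h₀ : ∀ p, g s₀ p = 0) :
    ∀ᶠ s in nhdsWithin s₀ (Set.Iio s₀), ∀ p ∈ K, g s p = 0 → |g' s₀ p| < r := by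
  have h1 : ∀ᶠ ξ in nhds s₀, ∀ p ∈ K, |g' s₀ p - g' ξ p| < r := by
    refine hK.eventually_forall_of_forall_eventually fun p _ => ?_
    have hc : Continuous fun z : ℝ × (ℝ × ℝ) => |g' s₀ z.2 - g' z.1 z.2| := by
      have h2 : Continuous fun z : ℝ × (ℝ × ℝ) => g' s₀ z.2 :=
        hg'.comp (continuous_const.prodMk continuous_snd)
      exact (h2.sub hg').abs
    exact hc.continuousAt.eventually (Iio_mem_nhds (by simpa using hr))
  obtain ⟨ε, hε, hball⟩ := Metric.eventually_nhds_iff.1 h1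
  filter_upwards [Ioo_mem_nhdsLT (show s₀ - ε < s₀ by linarith)] with s hs p hp hz
  obtain ⟨ξ, hξ, h2⟩ := exists_hasDerivAt_eq_zero (f := fun s => g s p) (f' := fun s => g' s p)
    hs.2 (fun s _ => (hg s p).continuousAt.continuousWithinAt) (by rw [hz, h₀])
    (fun s _ => hg s p)
  have := hball (y := ξ) (by rw [Real.dist_eq, abs_lt]; constructor <;> linarith [hs.1, hξ.1, hξ.2])
    p hp
  simpa [h2] using this

/-! ### Polar and stereographic coordinates on the sphere -/

theorem meridian_mem_sphere (θ s : ℝ) :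
    meridian θ s ∈ Metric.sphere (0 : EuclideanSpace ℝ (Fin 3)) 1 := by
  rw [mem_sphere_zero_iff_norm, EuclideanSpace.norm_eq, Real.sqrt_eq_one]
  simp only [Fin.sum_univ_three, meridian, Real.norm_eq_abs, sq_abs]
  simp
  nlinarith [Real.sin_sq_add_cos_sq s, Real.sin_sq_add_cos_sq θ]

/-- `meridian` as a map into the sphere. -/
noncomputable def meridianPoint (p : ℝ × ℝ) : TwoSphere :=
  ⟨meridian p.1 p.2, meridian_mem_sphere p.1 p.2⟩

theorem contDiff_meridian : ContDiff ℝ ∞ fun p : ℝ × ℝ => meridian p.1 p.2 := by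
  rw [contDiff_euclidean]
  intro i
  fin_cases i <;> simp [meridian] <;> fun_prop

theorem contMDiff_meridianPoint : ContMDiff 𝓘(ℝ, ℝ × ℝ) (𝓡 2) ∞ meridianPoint :=
  have := Fact.mk (finrank_euclideanSpace_fin (𝕜 := ℝ) (n := 2 + 1))
  contDiff_meridian.contMDiff.codRestrict_sphere fun p => meridian_mem_sphere p.1 p.2

theorem hasDerivAt_meridian (θ s : ℝ) :
    HasDerivAt (meridian θ)
      !₂[Real.cos s * Real.cos θ, Real.cos s * Real.sin θ, Real.sin s] s := by
  have h : HasDerivAt (fun t => ![Real.sin t * Real.cos θ, Real.sin t * Real.sin θ, -Real.cos t])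
      ![Real.cos s * Real.cos θ, Real.cos s * Real.sin θ, Real.sin s] s := by
    rw [hasDerivAt_pi]
    intro i
    fin_cases i
    · exact (Real.hasDerivAt_sin s).mul_const _
    · exact (Real.hasDerivAt_sin s).mul_const _
    · exact (neg_neg (Real.sin s)) ▸ (Real.hasDerivAt_cos s).neg
  exact (PiLp.continuousLinearEquiv 2 ℝ (fun _ : Fin 3 => ℝ)).symm.hasFDerivAt.comp_hasDerivAt s h

/-- Inverse stereographic projection from the north pole. -/
noncomputable def invStereo (b : ℂ) : EuclideanSpace ℝ (Fin 3) :=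
  !₂[2 * b.re / (1 + (b.re ^ 2 + b.im ^ 2)), 2 * b.im / (1 + (b.re ^ 2 + b.im ^ 2)),
    (b.re ^ 2 + b.im ^ 2 - 1) / (1 + (b.re ^ 2 + b.im ^ 2))]

theorem contDiff_invStereo : ContDiff ℝ ∞ invStereo := by
  have hre : ContDiff ℝ ∞ Complex.re := Complex.reCLM.contDiff
  have him : ContDiff ℝ ∞ Complex.im := Complex.imCLM.contDiff
  have h0 : ∀ b : ℂ, 1 + (b.re ^ 2 + b.im ^ 2) ≠ 0 := fun b => by positivity
  rw [contDiff_euclidean]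
  intro i
  fin_cases i <;> simp [invStereo] <;> refine ContDiff.div (by fun_prop) (by fun_prop) h0

theorem invStereo_mem_sphere (b : ℂ) :
    invStereo b ∈ Metric.sphere (0 : EuclideanSpace ℝ (Fin 3)) 1 := by
  rw [mem_sphere_zero_iff_norm, EuclideanSpace.norm_eq, Real.sqrt_eq_one]
  have h0 : 1 + (b.re ^ 2 + b.im ^ 2) ≠ 0 := by positivity
  simp only [Fin.sum_univ_three, invStereo, Real.norm_eq_abs, sq_abs]
  simp
  field_simp
  ring

/-- `invStereo` as a map into the sphere. -/
noncomputable def invStereoPoint (b : ℂ) : TwoSphere := ⟨invStereo b, invStereo_mem_sphere b⟩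

theorem contMDiff_invStereoPoint : ContMDiff 𝓘(ℝ, ℂ) (𝓡 2) ∞ invStereoPoint :=
  have := Fact.mk (finrank_euclideanSpace_fin (𝕜 := ℝ) (n := 2 + 1))
  contDiff_invStereo.contMDiff.codRestrict_sphere invStereo_mem_sphere

/-- Stereographic projection takes the circle of latitude at distance `2 arctan R` from the south
pole to the circle of radius `R`. -/
theorem invStereoPoint_polar (R α : ℝ) :
    invStereoPoint (R * Complex.exp (α * Complex.I)) = meridianPoint (α, 2 * Real.arctan R) := by
  have hre : (R * Complex.exp (α * Complex.I)).re = R * Real.cos α := by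
    simp [Complex.exp_ofReal_mul_I_re]
  have him : (R * Complex.exp (α * Complex.I)).im = R * Real.sin α := by
    simp [Complex.exp_ofReal_mul_I_im]
  have h1 : (R * Real.cos α) ^ 2 + (R * Real.sin α) ^ 2 = R ^ 2 := by
    linear_combination R ^ 2 * Real.sin_sq_add_cos_sq α
  have h0 : 1 + R ^ 2 ≠ 0 := by positivity
  have hs : Real.sin (2 * Real.arctan R) = 2 * R / (1 + R ^ 2) := by
    rw [Real.sin_two_mul, Real.sin_arctan, Real.cos_arctan]
    have : Real.sqrt (1 + R ^ 2) ^ 2 = 1 + R ^ 2 := Real.sq_sqrt (by positivity)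
    field_simp
    rw [this]
  have hc : Real.cos (2 * Real.arctan R) = (1 - R ^ 2) / (1 + R ^ 2) := by
    rw [Real.cos_two_mul, Real.cos_sq_arctan]
    field_simp
    ring
  apply Subtype.ext
  ext i
  fin_cases i <;>
    simp only [invStereoPoint, invStereo, meridianPoint, meridian, hre, him, h1, hs, hc] <;> simp <;>
    field_simp
  ring

theorem exists_invStereoPoint_eq (b : ℂ) :
    ∃ α : ℝ, invStereoPoint b = meridianPoint (α, 2 * Real.arctan ‖b‖) :=
  ⟨b.arg, by rw [← invStereoPoint_polar, Complex.norm_mul_exp_arg_mul_I]⟩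

/-! ### Derivatives along the circle -/

theorem mfderiv_circleExp_ne_zero (x : ℝ) :
    mfderiv 𝓘(ℝ, ℝ) (𝓡 1) Circle.exp x (1 : ℝ) ≠ 0 := by
  intro h0
  have h1 : MDifferentiableAt 𝓘(ℝ, ℝ) (𝓡 1) Circle.exp x :=
    (contMDiff_circleExp (m := 1)).mdifferentiableAt one_ne_zero
  have : Fact (Module.finrank ℝ ℂ = 1 + 1) := Complex.finrank_real_complex_fact
  have h2 : MDifferentiableAt (𝓡 1) 𝓘(ℝ, ℂ) (fun w : Circle => (w : ℂ)) (Circle.exp x) :=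
    (contMDiff_coe_sphere (m := 1) (E := ℂ) (n := 1)).mdifferentiableAt one_ne_zero
  have h3 : HasMFDerivAt 𝓘(ℝ, ℝ) 𝓘(ℝ, ℂ) ((fun w : Circle => (w : ℂ)) ∘ Circle.exp) x _ :=
    h2.hasMFDerivAt.comp x h1.hasMFDerivAt
  have h4 : HasDerivAt (fun y : ℝ => Complex.exp (y * Complex.I))
      (Complex.exp (x * Complex.I) * (1 * Complex.I)) x :=
    ((Complex.ofRealCLM.hasDerivAt (x := x)).mul_const Complex.I).cexp
  have h5 : ((fun w : Circle => (w : ℂ)) ∘ Circle.exp) = fun y : ℝ => Complex.exp (y * Complex.I) := by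
    ext y; simp
  rw [h5] at h3
  have h6 := h4.hasFDerivAt.unique h3.hasFDerivAt
  have h7 := congrArg (fun A : ℝ →L[ℝ] ℂ => A 1) h6
  -- the derivative of `y ↦ exp (y * I)` at `x` would vanish
  have h8 : ContinuousLinearMap.toSpanSingleton ℝ (Complex.exp (x * Complex.I) * (1 * Complex.I))
      (1 : ℝ) = (0 : ℂ) := h7.trans ((congrArg
    (mfderiv (𝓡 1) 𝓘(ℝ, ℂ) (fun w : Circle => (w : ℂ)) (Circle.exp x)) h0).trans
    (map_zero _))
  simp [Complex.exp_ne_zero] at h8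

/-- A function on the circle is critical at `exp x` exactly if its lift to `ℝ` is critical at
`x`. -/
theorem mfderiv_circle_eq_zero_iff {g : Circle → ℝ} (hg : ContMDiff (𝓡 1) 𝓘(ℝ, ℝ) ∞ g) (x : ℝ) :
    mfderiv (𝓡 1) 𝓘(ℝ, ℝ) g (Circle.exp x) = 0 ↔ deriv (fun y => g (Circle.exp y)) x = 0 := by
  have h1 : MDifferentiableAt 𝓘(ℝ, ℝ) (𝓡 1) Circle.exp x :=
    (contMDiff_circleExp (m := 1)).mdifferentiableAt one_ne_zero
  have h2 : MDifferentiableAt (𝓡 1) 𝓘(ℝ, ℝ) g (Circle.exp x) :=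
    hg.mdifferentiableAt (by simp)
  have h3 := mfderiv_comp x h2 h1
  rw [mfderiv_eq_fderiv] at h3
  have h4 : deriv (fun y => g (Circle.exp y)) x =
      mfderiv (𝓡 1) 𝓘(ℝ, ℝ) g (Circle.exp x) (mfderiv 𝓘(ℝ, ℝ) (𝓡 1) Circle.exp x (1 : ℝ)) :=
    congrArg (fun A : ℝ →L[ℝ] ℝ => A 1) h3
  rw [h4]
  constructor
  · intro h; rw [h]; rfl
  · intro h
    have hfr : Module.finrank ℝ (TangentSpace (𝓡 1) (Circle.exp x)) = 1 :=
      finrank_euclideanSpace_fin (𝕜 := ℝ) (n := 1)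
    ext v
    obtain ⟨c, hc⟩ := (finrank_eq_one_iff_of_nonzero' _ (mfderiv_circleExp_ne_zero x)).1 hfr v
    rw [← hc, map_smul, h]
    exact mul_zero c

/-! ### The critical points of a generating family on its fibres -/

theorem contDiff_pullback {F : TwoSphere × Circle → ℝ}
    (hF : ContMDiff ((𝓡 2).prod (𝓡 1)) 𝓘(ℝ, ℝ) ∞ F) {V : Type*} [NormedAddCommGroup V]
    [NormedSpace ℝ V] {c : V → TwoSphere} (hc : ContMDiff 𝓘(ℝ, V) (𝓡 2) ∞ c) :
    ContDiff ℝ ∞ fun p : V × ℝ => F (c p.1, Circle.exp p.2) := by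
  rw [← contMDiff_iff_contDiff]
  exact hF.comp ((hc.comp contDiff_fst.contMDiff).prodMk
    (contMDiff_circleExp.comp contDiff_snd.contMDiff))

theorem contMDiff_fibre {F : TwoSphere × Circle → ℝ}
    (hF : ContMDiff ((𝓡 2).prod (𝓡 1)) 𝓘(ℝ, ℝ) ∞ F) (q : TwoSphere) :
    ContMDiff (𝓡 1) 𝓘(ℝ, ℝ) ∞ fun w => F (q, w) :=
  hF.comp (contMDiff_const.prodMk contMDiff_id)

theorem eq_or_eq_of_cos_eq {s t : ℝ} (hs : s ∈ Set.Icc 0 Real.pi)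
    (ht : t ∈ Set.Icc 0 (2 * Real.pi)) (h : Real.cos t = Real.cos s) :
    t = s ∨ t = 2 * Real.pi - s := by
  rcases le_total t Real.pi with h1 | h1
  · exact .inl (Real.injOn_cos ⟨ht.1, h1⟩ hs h)
  · right
    have := Real.injOn_cos (x₁ := 2 * Real.pi - t) ⟨by linarith [ht.2], by linarith⟩ hs
      (by rw [Real.cos_two_pi_sub, h])
    linarith

/-- A fibre critical point over `γ_α(s)` gives one of the two points of `L_knot` above it. -/
theorem exists_of_fibre_critical {u : ℝ → ℝ} {F : TwoSphere × Circle → ℝ}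
    (hgen : IsGeneratingFamily (𝓡 2) (𝓡 1) F (knottedSphere u))
    {α s x : ℝ} (hs : s ∈ Set.Icc 0 Real.pi)
    (hx : deriv (fun y => F (meridianPoint (α, s), Circle.exp y)) x = 0) :
    ∃ θ t, (t = s ∨ t = 2 * Real.pi - s) ∧ F (meridianPoint (α, s), Circle.exp x) = u t ∧
      ∀ v : TangentSpace (𝓡 2) (meridianPoint (α, s)),
        mfderiv (𝓡 2) 𝓘(ℝ, ℝ) (fun q => F (q, Circle.exp x)) (meridianPoint (α, s)) v =
        deriv u t * inner ℝ (deriv (meridian θ) t)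
          (mfderiv (𝓡 2) 𝓘(ℝ, EuclideanSpace ℝ (Fin 3))
            (fun y : TwoSphere => (y : EuclideanSpace ℝ (Fin 3))) (meridianPoint (α, s)) v) := by
  have hmem : (⟨meridianPoint (α, s),
      mfderiv (𝓡 2) 𝓘(ℝ, ℝ) (fun q => F (q, Circle.exp x)) (meridianPoint (α, s)),
      F (meridianPoint (α, s), Circle.exp x)⟩ : JetOne (𝓡 2) TwoSphere) ∈ knottedSphere u := by
    rw [hgen.2]
    exact ⟨Circle.exp x, (mfderiv_circle_eq_zero_iff (contMDiff_fibre hgen.1 _) x).2 hx, rfl, rfl⟩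
  obtain ⟨θ, t, ht, hq, hp, hz⟩ := hmem
  refine ⟨θ, t, eq_or_eq_of_cos_eq hs ht ?_, hz, hp⟩
  have := congrArg (fun y : EuclideanSpace ℝ (Fin 3) => y 2) hq
  simpa [meridianPoint, meridian] using this.symm

/-- Each height of the front is attained in the fibre. -/
theorem exists_fibre_eq {u : ℝ → ℝ} {F : TwoSphere × Circle → ℝ}
    (hgen : IsGeneratingFamily (𝓡 2) (𝓡 1) F (knottedSphere u))
    (α : ℝ) {s : ℝ} (hs : s ∈ Set.Icc 0 (2 * Real.pi)) :
    ∃ w, F (meridianPoint (α, s), w) = u s := by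
  have hmem : (⟨meridianPoint (α, s),
      deriv u s • (innerSL ℝ (deriv (meridian α) s)).comp
        (mfderiv (𝓡 2) 𝓘(ℝ, EuclideanSpace ℝ (Fin 3))
            (fun y : TwoSphere => (y : EuclideanSpace ℝ (Fin 3))) (meridianPoint (α, s))),
      u s⟩ : JetOne (𝓡 2) TwoSphere) ∈ knottedSphere u :=
    ⟨α, s, hs, rfl, fun v => rfl, rfl⟩
  rw [hgen.2] at hmem
  obtain ⟨w, -, -, hz⟩ := hmem
  exact ⟨w, hz.symm⟩

/-- Above the north pole the front has a single point, so the function on the fibre has equal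
maximum and minimum. -/
theorem fibre_northPole_eq {u : ℝ → ℝ} {F : TwoSphere × Circle → ℝ}
    (hgen : IsGeneratingFamily (𝓡 2) (𝓡 1) F (knottedSphere u))
    (α : ℝ) (w : Circle) :
    F (meridianPoint (α, Real.pi), w) = u Real.pi := by
  have hc : Continuous fun w => F (meridianPoint (α, Real.pi), w) :=
    (contMDiff_fibre hgen.1 _).continuous
  have key : ∀ w : Circle, IsLocalExtr (fun w => F (meridianPoint (α, Real.pi), w)) w →
      F (meridianPoint (α, Real.pi), w) = u Real.pi := by
    intro w hw
    obtain ⟨x, rfl⟩ := Circle.isAddQuotientCoveringMap_exp.surjective w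
    have hx : IsLocalExtr (fun y => F (meridianPoint (α, Real.pi), Circle.exp y)) x :=
      hw.comp_continuous Circle.exp.continuous.continuousAt
    obtain ⟨-, t, ht, h, -⟩ := exists_of_fibre_critical hgen
      ⟨Real.pi_pos.le, le_rfl⟩ hx.deriv_eq_zero
    rw [h]
    congr 1
    rcases ht with ht | ht <;> linarith
  obtain ⟨a, -, ha⟩ := isCompact_univ.exists_isMaxOn Set.univ_nonempty hc.continuousOn
  obtain ⟨b, -, hb⟩ := isCompact_univ.exists_isMinOn Set.univ_nonempty hc.continuousOn
  have h1 := key a (.inr (Filter.Eventually.of_forall fun y => ha (Set.mem_univ y)))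
  have h2 := key b (.inl (Filter.Eventually.of_forall fun y => hb (Set.mem_univ y)))
  have h3 : F (meridianPoint (α, Real.pi), w) ≤ F (meridianPoint (α, Real.pi), a) :=
    ha (Set.mem_univ w)
  have h4 : F (meridianPoint (α, Real.pi), b) ≤ F (meridianPoint (α, Real.pi), w) :=
    hb (Set.mem_univ w)
  linarith

/-- The chain rule along a meridian, for a differential given by a covector of the ambient space. -/
theorem hasDerivAt_comp_meridianPoint {g : TwoSphere → ℝ} (hg : ContMDiff (𝓡 2) 𝓘(ℝ, ℝ) ∞ g)
    {q : TwoSphere} {k : ℝ} {ℓ : EuclideanSpace ℝ (Fin 3)}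
    (hq : ∀ v : TangentSpace (𝓡 2) q, mfderiv (𝓡 2) 𝓘(ℝ, ℝ) g q v =
      k * inner ℝ ℓ (mfderiv (𝓡 2) 𝓘(ℝ, EuclideanSpace ℝ (Fin 3))
        (fun y : TwoSphere => (y : EuclideanSpace ℝ (Fin 3))) q v))
    {α s : ℝ} (h : meridianPoint (α, s) = q) :
    HasDerivAt (fun t => g (meridianPoint (α, t))) (k * inner ℝ ℓ (deriv (meridian α) s)) s := by
  subst h
  have := Fact.mk (finrank_euclideanSpace_fin (𝕜 := ℝ) (n := 2 + 1))
  have hc : MDifferentiableAt 𝓘(ℝ, ℝ) (𝓡 2) (fun t => meridianPoint (α, t)) s :=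
    ((contMDiff_meridianPoint.comp (g := meridianPoint) (f := fun t : ℝ => (α, t))
      (contDiff_prodMk_right α).contMDiff).mdifferentiableAt (by simp))
  have hι : MDifferentiableAt (𝓡 2) 𝓘(ℝ, EuclideanSpace ℝ (Fin 3))
      (fun y : TwoSphere => (y : EuclideanSpace ℝ (Fin 3))) (meridianPoint (α, s)) :=
    (contMDiff_coe_sphere (m := 1) (E := EuclideanSpace ℝ (Fin 3)) (n := 2)).mdifferentiableAt
      one_ne_zero
  let C := mfderiv 𝓘(ℝ, ℝ) (𝓡 2) (fun t => meridianPoint (α, t)) s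
  let A : ℝ →L[ℝ] ℝ := (mfderiv (𝓡 2) 𝓘(ℝ, ℝ) g (meridianPoint (α, s))).comp C
  let B : ℝ →L[ℝ] EuclideanSpace ℝ (Fin 3) :=
    (mfderiv (𝓡 2) 𝓘(ℝ, EuclideanSpace ℝ (Fin 3))
      (fun y : TwoSphere => (y : EuclideanSpace ℝ (Fin 3))) (meridianPoint (α, s))).comp C
  have h1 : HasFDerivAt (fun t => g (meridianPoint (α, t))) A s :=
    ((hg.mdifferentiableAt (x := meridianPoint (α, s)) (by simp)).hasMFDerivAt.comp s
      hc.hasMFDerivAt).hasFDerivAt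
  have h2 : HasFDerivAt (fun t => ((meridianPoint (α, t) : TwoSphere) : EuclideanSpace ℝ (Fin 3)))
      B s :=
    (hι.hasMFDerivAt.comp s hc.hasMFDerivAt).hasFDerivAt
  -- `meridianPoint` composed with the inclusion of the sphere is `meridian`
  rw [show deriv (meridian α) s = B 1 from h2.hasDerivAt.deriv]
  convert! h1.hasDerivAt using 1
  exact (hq _).symm

theorem inner_deriv_meridian_pi (θ α : ℝ) :
    inner ℝ (deriv (meridian θ) Real.pi) (deriv (meridian α) Real.pi) = Real.cos (α - θ) := by
  rw [(hasDerivAt_meridian _ _).deriv, (hasDerivAt_meridian _ _).deriv]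
  simp [PiLp.inner_apply, Fin.sum_univ_three, Real.cos_sub]

/-- At the north pole the differential of `F (·, w)` is one of the covectors of the front cone: the
differential of the rotationally symmetric front along the meridian of some angle `θ`. -/
theorem exists_angle_northPole {u : ℝ → ℝ} {F : TwoSphere × Circle → ℝ}
    (hgen : IsGeneratingFamily (𝓡 2) (𝓡 1) F (knottedSphere u)) (w : Circle) :
    ∃ θ, ∀ α, HasDerivAt (fun s => F (meridianPoint (α, s), w))
      (deriv u Real.pi * Real.cos (α - θ)) Real.pi := by
  obtain ⟨x, rfl⟩ := Circle.isAddQuotientCoveringMap_exp.surjective w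
  -- `F` is constant on this fibre, so every point of it is critical
  have h0 : deriv (fun y => F (meridianPoint (0, Real.pi), Circle.exp y)) x = 0 := by
    simp [fibre_northPole_eq hgen]
  obtain ⟨θ, t, ht, -, h⟩ := exists_of_fibre_critical hgen ⟨Real.pi_pos.le, le_rfl⟩ h0
  obtain rfl : t = Real.pi := by rcases ht with ht | ht <;> linarith
  refine ⟨θ, fun α => ?_⟩
  rw [← inner_deriv_meridian_pi]
  refine hasDerivAt_comp_meridianPoint (g := fun q => F (q, Circle.exp x))
    (hgen.1.comp (contMDiff_id.prodMk contMDiff_const)) h (Subtype.ext ?_)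
  ext i
  fin_cases i <;> simp [meridianPoint, meridian]

/-! ### The mid-height section -/

theorem IsKnotProfile.strictAntiOn {u : ℝ → ℝ} (hu : IsKnotProfile u) :
    StrictAntiOn u (Set.Icc 0 (2 * Real.pi)) :=
  strictAntiOn_of_deriv_neg (convex_Icc _ _) hu.smooth.continuous.continuousOn
    (by rw [interior_Icc]; exact hu.deriv_neg)

/-- The height halfway between the two sheets of the front of profile `u`, at distance `s` from the
south pole. -/
noncomputable def midHeight (u : ℝ → ℝ) (s : ℝ) : ℝ := (u s + u (2 * Real.pi - s)) / 2

theorem contDiff_midHeight {u : ℝ → ℝ} (hu : ContDiff ℝ ∞ u) : ContDiff ℝ ∞ (midHeight u) := by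
  unfold midHeight
  fun_prop

theorem midHeight_pi (u : ℝ → ℝ) : midHeight u Real.pi = u Real.pi := by
  rw [midHeight, show 2 * Real.pi - Real.pi = Real.pi by ring]
  ring

/-- The slopes of the two sheets at the front cone cancel. -/
theorem deriv_midHeight_pi {u : ℝ → ℝ} (hu : ContDiff ℝ ∞ u) :
    deriv (midHeight u) Real.pi = 0 := by
  have h1 : HasDerivAt u (deriv u Real.pi) Real.pi :=
    (hu.differentiable (by simp) Real.pi).hasDerivAt
  have h2 : HasDerivAt u (deriv u Real.pi) (2 * Real.pi - Real.pi) := by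
    rwa [show 2 * Real.pi - Real.pi = Real.pi by ring]
  have h3 := (h1.add (h2.comp_const_sub (2 * Real.pi) Real.pi)).div_const 2
  refine (h3.deriv : deriv (midHeight u) Real.pi = _).trans ?_
  ring

/-- Away from the north pole the mid-height is a regular value of `F` on the fibres, so it is
attained along a section. -/
theorem exists_midHeight_section {u : ℝ → ℝ} (hu : IsKnotProfile u) {F : TwoSphere × Circle → ℝ}
    (hgen : IsGeneratingFamily (𝓡 2) (𝓡 1) F (knottedSphere u)) :
    ∃ X : ℂ → ℝ, Continuous X ∧ ∀ b,
      F (invStereoPoint b, Circle.exp (X b)) = midHeight u (2 * Real.arctan ‖b‖) := by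
  have hpi := Real.pi_pos
  have hu' := hu.strictAntiOn
  -- the south pole, where both heights are attained, provides a starting point
  have hex : ∃ w, F (invStereoPoint 0, w) = midHeight u (2 * Real.arctan ‖(0 : ℂ)‖) := by
    obtain ⟨α, hα⟩ := exists_invStereoPoint_eq 0
    rw [hα, norm_zero, Real.arctan_zero, mul_zero]
    have hend : meridianPoint (α, 2 * Real.pi) = meridianPoint (α, 0) := by
      apply Subtype.ext
      simp [meridianPoint, meridian]
    obtain ⟨w₀, h₀⟩ := exists_fibre_eq hgen α (s := 0) ⟨le_rfl, by positivity⟩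
    obtain ⟨w₁, h₁⟩ := exists_fibre_eq hgen α (s := 2 * Real.pi) ⟨by positivity, le_rfl⟩
    rw [hend] at h₁
    obtain ⟨x₀, rfl⟩ := Circle.isAddQuotientCoveringMap_exp.surjective w₀
    obtain ⟨x₁, rfl⟩ := Circle.isAddQuotientCoveringMap_exp.surjective w₁
    have hlt : u (2 * Real.pi) < u 0 :=
      hu' ⟨le_rfl, by positivity⟩ ⟨by positivity, le_rfl⟩ (by positivity)
    have hcont : Continuous fun x => F (meridianPoint (α, 0), Circle.exp x) :=
      (contMDiff_fibre hgen.1 _).continuous.comp Circle.exp.continuous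
    obtain ⟨x, hx⟩ := mem_range_of_exists_le_of_exists_ge (c := midHeight u 0) hcont
      ⟨x₁, by rw [h₁, midHeight, sub_zero]; linarith⟩
      ⟨x₀, by rw [h₀, midHeight, sub_zero]; linarith⟩
    exact ⟨_, hx⟩
  obtain ⟨w, hw⟩ := hex
  refine exists_continuous_levelSection (f := fun p => F (invStereoPoint p.1, p.2))
    (m := fun b => midHeight u (2 * Real.arctan ‖b‖)) (b₀ := 0) (w₀ := w) ?_ ?_ ?_ ?_ hw
  · exact hgen.1.continuous.comp
      ((contMDiff_invStereoPoint.continuous.comp continuous_fst).prodMk continuous_snd)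
  · exact (contDiff_pullback hgen.1 contMDiff_invStereoPoint).of_le (by simp)
  · exact (contDiff_midHeight hu.smooth).continuous.comp
      (continuous_const.mul (Real.continuous_arctan.comp continuous_norm))
  · intro b x hx hcrit
    obtain ⟨α, hα⟩ := exists_invStereoPoint_eq b
    simp only [hα] at hx hcrit
    set s := 2 * Real.arctan ‖b‖
    have hs₀ : 0 ≤ s := mul_nonneg zero_le_two (Real.arctan_nonneg.2 (norm_nonneg b))
    have hs₁ : s < Real.pi := by have := Real.arctan_lt_pi_div_two ‖b‖; simp only [s]; linarith
    obtain ⟨-, t, ht, h, -⟩ := exists_of_fibre_critical hgen ⟨hs₀, hs₁.le⟩ hcrit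
    have hlt : u (2 * Real.pi - s) < u s :=
      hu' ⟨hs₀, by linarith⟩ ⟨by linarith, by linarith⟩ (by linarith)
    rw [hx, midHeight] at h
    rcases ht with rfl | rfl <;> linarith

/-! ### Non-existence of a generating family -/

theorem mainTheorem7 (u : ℝ → ℝ) (hu : IsKnotProfile u) :
    ¬ ∃ F : TwoSphere × Circle → ℝ,
      IsGeneratingFamily (𝓡 2) (𝓡 1) F (knottedSphere u) := by
  rintro ⟨F, hgen⟩
  have hpi := Real.pi_pos
  obtain ⟨X, hX, hXm⟩ := exists_midHeight_section hu hgen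
  have hr : deriv u Real.pi ≠ 0 := (hu.deriv_neg _ ⟨hpi, by linarith⟩).ne
  -- `F` in polar coordinates `(α, s)` about the south pole and its radial derivative
  set H : (ℝ × ℝ) × ℝ → ℝ := fun z => F (meridianPoint z.1, Circle.exp z.2)
  have hH : ContDiff ℝ ∞ H := contDiff_pullback hgen.1 contMDiff_meridianPoint
  set D : ℝ → ℝ × ℝ → ℝ := fun s p => fderiv ℝ H ((p.1, s), p.2) ((0, 1), 0)
  have hHD : ∀ s p, HasDerivAt (fun s => H ((p.1, s), p.2)) (D s p) s := fun s p =>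
    (hH.differentiable (by simp) ((p.1, s), p.2)).hasFDerivAt.comp_hasDerivAt
      (f := fun s => ((p.1, s), p.2)) s
      (((hasDerivAt_const s p.1).prodMk (hasDerivAt_id s)).prodMk (hasDerivAt_const s p.2))
  have hDc : Continuous (Function.uncurry D) :=
    ((hH.continuous_fderiv (by simp)).comp (g := fderiv ℝ H)
      (f := fun z : ℝ × (ℝ × ℝ) => ((z.2.1, z.1), z.2.2)) (by fun_prop)).clm_apply
      continuous_const
  -- the angle of the front cone over each point of the fibre
  obtain ⟨Θ, hΘ, hDΘ⟩ := exists_continuous_angle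
    (P := fun α x => D Real.pi (α, x) / deriv u Real.pi)
    (fun α => (hDc.comp (f := fun x : ℝ => (Real.pi, (α, x))) (by fun_prop)).div_const _)
    (fun x => by
      obtain ⟨θ, hθ⟩ := exists_angle_northPole hgen (Circle.exp x)
      refine ⟨θ, fun α => ?_⟩
      rw [(hHD Real.pi (α, x)).unique (hθ α), mul_div_cancel_left₀ _ hr])
  -- near the north pole the section runs where the radial slope at the pole is less than that
  -- of the cone; `[-π, π]` contains a parameter of each point of the circle
  have hm := contDiff_midHeight hu.smooth
  obtain ⟨s, hs, hs₀, hs₁⟩ := ((eventually_abs_deriv_lt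
      (K := Set.Icc 0 (2 * Real.pi) ×ˢ Set.Icc (-Real.pi) Real.pi) (isCompact_Icc.prod isCompact_Icc)
      (g := fun s p => H ((p.1, s), p.2) - midHeight u s)
      (g' := fun s p => D s p - deriv (midHeight u) s)
      (fun s p => (hHD s p).sub (hm.differentiable (by simp) s).hasDerivAt)
      (hDc.sub ((hm.continuous_deriv (by simp)).comp continuous_fst)) (s₀ := Real.pi)
      (abs_pos.2 hr) (fun p => by
        simp [H, fibre_northPole_eq hgen, midHeight_pi])).and
    (Ioo_mem_nhdsLT hpi)).exists
  have hR : 0 ≤ Real.tan (s / 2) :=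
    Real.tan_nonneg_of_nonneg_of_le_pi_div_two (by linarith) (by linarith)
  have hRs : 2 * Real.arctan (Real.tan (s / 2)) = s := by
    rw [Real.arctan_tan (by linarith) (by linarith)]
    ring
  set γ : ℝ → ℂ := fun α => Real.tan (s / 2) * Complex.exp (α * Complex.I) with hγ
  have hγc : Continuous γ := by fun_prop
  obtain ⟨α, hα, hcos⟩ := exists_abs_cos_sub_eq_one (Θ := fun α => Θ (X (γ α))) (by fun_prop) (by
    simp [hγ])
  -- the parameter `X (γ α)` is moved into the compact interval `[-π, π]`
  set x := X (γ α)
  have hx' : Circle.exp (Complex.arg (Circle.exp x)) = Circle.exp x := Circle.exp_arg _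
  have hFx := hXm (γ α)
  have hnorm : ‖γ α‖ = Real.tan (s / 2) := by
    simp only [hγ, norm_mul, Complex.norm_exp_ofReal_mul_I, Complex.norm_real, Real.norm_eq_abs,
      abs_of_nonneg hR, mul_one]
  rw [hnorm, invStereoPoint_polar, hRs] at hFx
  have h1 := hs (α, Complex.arg (Circle.exp x))
    ⟨hα, (Complex.neg_pi_lt_arg _).le, Complex.arg_le_pi _⟩ (by
      simp only [H, hx']
      rw [hFx, sub_self])
  have h2 : D Real.pi (α, Complex.arg (Circle.exp x)) = D Real.pi (α, x) := by
    refine (hHD Real.pi (α, Complex.arg (Circle.exp x))).unique ?_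
    simpa only [H, hx'] using hHD Real.pi (α, x)
  have h3 : D Real.pi (α, x) = Real.cos (α - Θ x) * deriv u Real.pi :=
    (div_eq_iff hr).1 (hDΘ x α)
  rw [deriv_midHeight_pi hu.smooth, sub_zero, h2, h3, abs_mul, hcos, one_mul] at h1
  exact lt_irrefl _ h1
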